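/- Let $\mathbb{D}$ be the open unit disk, $\mathbb{T}$ the unit circle with normalized Lebesgue measure $m$, and $H^2$, $H^\infty$ the usual Hardy spaces on $\mathbb{D}$, where functions in $H^2$ are identified with their boundary functions in $L^2 = L^2(\mathbb{T}, m)$. For an inner function $\Theta$ let $\mathcal{K}_\Theta = H^2 \cap (\Theta H^2)^\perp$, and for inner functions $u, v$ let $$\mathscr{M}(u,v) = \{\varphi \in \operatorname{Hol}(\mathbb{D}) : \varphi \mathcal{K}_u \subseteq \mathcal{K}_v\}.$$ Let $S^* f(z) = (f(z)-f(0))/z$ denote the backward shift, let $P_+$ be the orthogonal projection of $L^2$ onto $H^2$, and for $g \in L^\infty(\mathbb{T})$ let $T_g f = P_+(g f)$, $f \in H^2$, be the Toeplitz operator on $H^2$ with symbol $g$. For $\varphi \in H^2$, the measure $|\varphi|^2\,dm$ is called a Carleson measure for $\mathcal{K}_u$ if there is a constant $C$ such that $$\int_{\mathbb{T}} |f|^2 |\varphi|^2 \, dm \le C \|f\|^2 \quad \text{for all } f \in \mathcal{K}_u.$$ Let $u$ and $v$ be inner functions with $u$ non-constant, and let $\varphi \in H^2$. Then the following are equivalent: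 (i) $\varphi \in \mathscr{M}(u,v)$; (ii) $\varphi S^* u \in \mathcal{K}_v$ and $|\varphi|^2 \, dm$ is a Carleson measure for $\mathcal{K}_u$; (iii) $\varphi \in \ker T_{\overline{zv}u}$ and $|\varphi|^2 \, dm$ is a Carleson measure for $\mathcal{K}_u$. Furthermore, the following are equivalent: (iv) $\varphi \in \mathscr{M}(u,v) \cap H^\infty$; (v) $\varphi S^* u \in \mathcal{K}_v \cap H^\infty$; (vi) $\varphi \in \ker T_{\overline{zv}u} \cap H^\infty$. -/

import Mathlib

open MeasureTheory Filter Topology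
open scoped ENNReal NNReal ComplexConjugate

noncomputable section

namespace ModelSpace

/-- Normalized Lebesgue measure `m` on the unit circle `𝕋`. The circle is parametrized by
`t ∈ ℝ / ℤ` through `t ↦ exp (2 π i t) = fourier 1 t`. -/
abbrev m : Measure UnitAddCircle := AddCircle.haarAddCircle

/-- `L² = L²(𝕋, m)`. -/
abbrev L2 : Type := Lp ℂ 2 m

/-- The open unit disk. Functions on the disk are represented by functions `ℂ → ℂ`, of which
only the values on the disk matter. -/
abbrev disk : Set ℂ := Metric.ball (0 : ℂ) 1

/-- The trace `t ↦ f (r exp (2 π i t))` of `f` on the circle of radius `r`. -/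
def dilate (f : ℂ → ℂ) (r : ℝ) (t : UnitAddCircle) : ℂ :=
  f ((r : ℂ) * fourier 1 t)

/-- `Hol(𝔻)`. -/
def Hol : Set (ℂ → ℂ) := {f | DifferentiableOn ℂ f disk}

/-- The Hardy space `H²`: holomorphic functions on the disk with bounded quadratic means. -/
def H2 : Set (ℂ → ℂ) :=
  {f | f ∈ Hol ∧ ∃ C : ℝ, ∀ r : ℝ, 0 ≤ r → r < 1 → ∫ t, ‖dilate f r t‖ ^ 2 ∂m ≤ C}

/-- The space `H^∞` of bounded holomorphic functions on the disk. -/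
def Hinfty : Set (ℂ → ℂ) :=
  {f | f ∈ Hol ∧ ∃ C : ℝ, ∀ z ∈ disk, ‖f z‖ ≤ C}

/-- `u` is inner: bounded and holomorphic on the disk, with radial limits of modulus one at
almost every point of the circle. -/
def IsInner (u : ℂ → ℂ) : Prop :=
  u ∈ Hinfty ∧ ∀ᵐ t ∂m, ∃ w : ℂ, ‖w‖ = 1 ∧ Tendsto (fun r : ℝ => dilate u r t) (𝓝[<] 1) (𝓝 w)

/-- `F` is the boundary function of `f`: the limit in `L²` of the dilates of `f`. -/
def IsBoundaryFunction (f : ℂ → ℂ) (F : L2) : Prop :=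
  Tendsto (fun r : ℝ => eLpNorm (fun t => dilate f r t - F t) 2 m) (𝓝[<] 1) (𝓝 0)

/-- The boundary function of `f`, meaningful for `f ∈ H²`. -/
def bdry (f : ℂ → ℂ) : L2 := Classical.epsilon (IsBoundaryFunction f)

/-- The model space `𝒦_Θ = H² ∩ (Θ H²)^⊥`, where the inner product of two functions in `H²` is
the inner product in `L²` of their boundary functions. -/
def K (Θ : ℂ → ℂ) : Set (ℂ → ℂ) :=
  {f | f ∈ H2 ∧ ∀ h ∈ H2, inner ℂ (bdry (fun z => Θ z * h z)) (bdry f) = 0}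

/-- The multipliers `𝓜(u, v) = {φ ∈ Hol(𝔻) : φ 𝒦_u ⊆ 𝒦_v}`. -/
def Multipliers (u v : ℂ → ℂ) : Set (ℂ → ℂ) :=
  {φ | φ ∈ Hol ∧ ∀ f ∈ K u, (fun z => φ z * f z) ∈ K v}

/-- The backward shift `(S^* f)(z) = (f z - f 0) / z`, with value `f' 0` at `z = 0`. -/
def backwardShift (f : ℂ → ℂ) : ℂ → ℂ := dslope f 0

/-- `|φ|² dm` is a Carleson measure for `𝒦_u`. -/
def IsCarleson (φ u : ℂ → ℂ) : Prop :=
  ∃ C : ℝ≥0, ∀ f ∈ K u,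
    ∫⁻ t, ‖bdry f t‖ₑ ^ 2 * ‖bdry φ t‖ₑ ^ 2 ∂m ≤ C * ‖bdry f‖ₑ ^ 2

/-- `H²` as a closed subspace of `L²`: the closed span of the functions `z ^ n`, `n ≥ 0`. -/
def H2T : Submodule ℂ L2 :=
  (Submodule.span ℂ (Set.range fun n : ℕ => (fourierLp 2 (n : ℤ) : L2))).topologicalClosure

instance : CompleteSpace H2T :=
  inferInstanceAs (CompleteSpace (Submodule.topologicalClosure _))

/-- Multiplication by `g ∈ L^∞` on `L²`. -/
def mulOp (g : Lp ℂ ∞ m) : L2 →L[ℂ] L2 :=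
  (ContinuousLinearMap.mul ℂ ℂ).holderL m ∞ 2 2 g

/-- The Toeplitz operator `T_g f = P₊ (g f)` on `H²`, where `P₊` is the orthogonal projection
of `L²` onto `H²`. -/
def toeplitz (g : Lp ℂ ∞ m) : H2T →L[ℂ] H2T :=
  H2T.orthogonalProjectionOnto ∘L mulOp g ∘L H2T.subtypeL

/-- The kernel of `T_g`, as a set of functions on the disk. -/
def kerToeplitz (g : Lp ℂ ∞ m) : Set (ℂ → ℂ) :=
  {f | f ∈ H2 ∧ ∃ hf : bdry f ∈ H2T, toeplitz g ⟨bdry f, hf⟩ = 0}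

lemma dilate_continuous {f : ℂ → ℂ} (hf : f ∈ Hol) {r : ℝ} (h0 : 0 ≤ r) (h1 : r < 1) :
    Continuous (dilate f r) := by
  have hc : ContinuousOn f disk := DifferentiableOn.continuousOn hf
  refine hc.comp_continuous (by fun_prop) fun t => ?_
  simp [Circle.norm_coe, abs_of_nonneg h0, h1]

lemma norm_dilate_le {f : ℂ → ℂ} {C : ℝ} (hf : ∀ z ∈ disk, ‖f z‖ ≤ C) {r : ℝ}
    (h0 : 0 ≤ r) (h1 : r < 1) (t : UnitAddCircle) : ‖dilate f r t‖ ≤ C := by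
  refine hf _ ?_
  simp [Circle.norm_coe, abs_of_nonneg h0, h1]

lemma eventually_radius : ∀ᶠ r : ℝ in 𝓝[<] 1, 0 ≤ r ∧ r < 1 := by
  filter_upwards [Ioo_mem_nhdsLT (show (0 : ℝ) < 1 by norm_num)] with r hr
  exact ⟨hr.1.le, hr.2⟩

/-- The boundary function of an inner function is unimodular almost everywhere. -/
lemma IsInner.norm_bdry {u : ℂ → ℂ} (hu : IsInner u) : ∀ᵐ t ∂m, ‖bdry u t‖ = 1 := by
  obtain ⟨⟨hol, C, hC⟩, hlim⟩ := hu
  choose! w hw using fun (t : UnitAddCircle)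
    (h : ∃ w : ℂ, ‖w‖ = 1 ∧ Tendsto (fun r : ℝ => dilate u r t) (𝓝[<] 1) (𝓝 w)) => h
  have hw' : ∀ᵐ t ∂m, ‖w t‖ = 1 ∧ Tendsto (fun r : ℝ => dilate u r t) (𝓝[<] 1) (𝓝 (w t)) := by
    filter_upwards [hlim] with t ht using hw t ht
  obtain ⟨s, hs⟩ := exists_seq_tendsto (𝓝[<] (1 : ℝ))
  obtain ⟨N, hN⟩ := eventually_atTop.1 (hs.eventually eventually_radius)
  have hs' : Tendsto (fun n => s (n + N)) atTop (𝓝[<] 1) := hs.comp (tendsto_add_atTop_nat N)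
  have hmeas : AEStronglyMeasurable w m := by
    refine aestronglyMeasurable_of_tendsto_ae atTop (f := fun n => dilate u (s (n + N)))
      (fun n => ?_) ?_
    · have := hN (n + N) (by omega)
      exact (dilate_continuous hol this.1 this.2).aestronglyMeasurable
    · filter_upwards [hw'] with t ht using ht.2.comp hs'
  have hmem : MemLp w 2 m :=
    MemLp.of_bound hmeas 1 (by filter_upwards [hw'] with t ht using ht.1.le)
  have hex : IsBoundaryFunction u (hmem.toLp w) := by
    have hae : ∀ᵐ t ∂m, Tendsto (fun r : ℝ => dilate u r t) (𝓝[<] 1) (𝓝 (hmem.toLp w t)) ∧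
        ‖hmem.toLp w t‖ = 1 := by
      filter_upwards [hw', hmem.coeFn_toLp] with t ht h
      rw [h]; exact ⟨ht.2, ht.1⟩
    have h2 : Tendsto (fun r : ℝ => ∫⁻ t, ‖dilate u r t - hmem.toLp w t‖ₑ ^ (2 : ℝ) ∂m)
        (𝓝[<] 1) (𝓝 (∫⁻ _, 0 ∂m)) := by
      refine tendsto_lintegral_filter_of_dominated_convergence
        (fun _ => (ENNReal.ofReal (C + 1)) ^ (2 : ℝ)) ?_ ?_ (by simp) ?_
      · filter_upwards [eventually_radius] with r hr
        exact ((dilate_continuous hol hr.1 hr.2).measurable.sub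
          (Lp.stronglyMeasurable _).measurable).enorm.pow_const _
      · filter_upwards [eventually_radius] with r hr
        filter_upwards [hae] with t ht
        gcongr
        rw [← ofReal_norm]
        gcongr
        refine (norm_sub_le _ _).trans ?_
        rw [ht.2]
        gcongr
        exact norm_dilate_le hC hr.1 hr.2 t
      · filter_upwards [hae] with t ht
        have := (ht.1.sub_const (hmem.toLp w t)).enorm.ennrpow_const 2
        simpa using this
    have h3 := h2.ennrpow_const (1 / 2)
    unfold IsBoundaryFunction
    simp_rw [eLpNorm_eq_lintegral_rpow_enorm_toReal (p := 2) (by norm_num) (by norm_num)]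
    simpa using h3
  have hb : IsBoundaryFunction u (bdry u) := Classical.epsilon_spec ⟨_, hex⟩
  have hms : TendstoInMeasure m (fun n => dilate u (s (n + N))) atTop (bdry u) := by
    refine tendstoInMeasure_of_tendsto_eLpNorm (p := 2) (by norm_num) (fun n => ?_)
      (Lp.aestronglyMeasurable _) (hb.comp hs')
    have := hN (n + N) (by omega)
    exact (dilate_continuous hol this.1 this.2).aestronglyMeasurable
  obtain ⟨ns, hns, hns'⟩ := hms.exists_seq_tendsto_ae
  filter_upwards [hw', hns'] with t ht ht'
  have := tendsto_nhds_unique ht' ((ht.2.comp hs').comp hns.tendsto_atTop)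
  rw [this, ht.1]

lemma memLp_symbol {u v : ℂ → ℂ} (hu : IsInner u) (hv : IsInner v) :
    MemLp (fun t => conj (fourier 1 t * bdry v t) * bdry u t) ∞ m := by
  refine memLp_top_of_bound ?_ 1 ?_
  · refine AEStronglyMeasurable.mul ?_ (Lp.aestronglyMeasurable _)
    exact Complex.continuous_conj.comp_aestronglyMeasurable
      ((fourier 1).continuous.aestronglyMeasurable.mul (Lp.aestronglyMeasurable _))
  · filter_upwards [hu.norm_bdry, hv.norm_bdry] with t h1 h2
    simp [h1, h2, Circle.norm_coe]

/-- The symbol `\overline{z v} u ∈ L^∞`. -/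
def symbol {u v : ℂ → ℂ} (hu : IsInner u) (hv : IsInner v) : Lp ℂ ∞ m :=
  (memLp_symbol hu hv).toLp

end ModelSpace

end

open MeasureTheory Filter Topology
open scoped ENNReal NNReal ComplexConjugate

noncomputable section

namespace ModelSpace

/-! Everything is read off one function on the circle, W = conj(zv) u φ (`twist`). Membership of φ
in the Toeplitz kernel says exactly that W is orthogonal to H², that is, its Fourier coefficients of
index n ≥ 0 vanish; likewise f ∈ H² lies in K_Θ iff conj(Θ) f is orthogonal to H².

On the circle S^*u = conj(z)(u - u(0)), so |u| = 1 gives conj(v) φ S^*u = conj(q) W with q = 1 -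
conj(u(0)) u. Since u is not constant, |u(0)| < 1 and q is invertible in H^∞. Multiplication by
conj(h), h ∈ H^∞, preserves the complement of H², so φ S^*u ∈ K_v iff W is orthogonal to H²
(`mul_backwardShift_mem_K_iff`). The case v = u, φ = 1, where W = conj(z), puts S^*u itself in K_u;
a multiplier may therefore be tested on it.

Conversely, for f ∈ K_u the conjugate function g = conj(z) u conj(f) is in H², and conj(v) φ f = W
conj(g). The Carleson condition puts φ f in L², hence in H², and the pairing of W with z^n g
vanishes for every n ≥ 0, so φ f ∈ K_v (`mem_multipliers`). That a multiplier satisfies the Carleson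
condition is the closed graph theorem (`isCarleson_of_mul_mem_H2`).

In the bounded case the Carleson condition is automatic, and |S^*u| = |u - u(0)| ≥ 1 - |u(0)| a.e.
on the circle, so φ is bounded as soon as φ S^*u is. -/

/-! ### Taylor and Fourier coefficients -/

/-- `a` is the sequence of Taylor coefficients of `f` at the origin. -/
def HasTaylor (f : ℂ → ℂ) (a : ℕ → ℂ) : Prop :=
  ∀ z ∈ disk, HasSum (fun n => a n * z ^ n) (f z)

/-- Extension of a sequence by zero to negative indices. -/
def extendZero (a : ℕ → ℂ) : ℤ → ℂ
  | Int.ofNat n => a n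
  | Int.negSucc _ => 0

@[simp] lemma extendZero_natCast (a : ℕ → ℂ) (n : ℕ) : extendZero a (n : ℤ) = a n := rfl

@[simp] lemma extendZero_negSucc (a : ℕ → ℂ) (n : ℕ) : extendZero a (Int.negSucc n) = 0 := rfl

lemma exists_hasTaylor {f : ℂ → ℂ} (hf : f ∈ Hol) : ∃ a, HasTaylor f a := by
  refine ⟨fun n => (n.factorial : ℂ)⁻¹ * iteratedDeriv n f 0, fun z hz => ?_⟩
  have := Complex.hasSum_taylorSeries_on_ball (f := f) (c := 0) (r := 1) hf hz
  refine this.congr_fun ?_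
  intro n
  simp only [sub_zero, smul_eq_mul]
  ring

lemma mem_disk_of_radius {r : ℝ} (h0 : 0 ≤ r) (h1 : r < 1) (t : UnitAddCircle) :
    (r : ℂ) * fourier 1 t ∈ disk := by
  simp [Circle.norm_coe, abs_of_nonneg h0, h1]

lemma ofReal_mem_disk {r : ℝ} (h0 : 0 ≤ r) (h1 : r < 1) : (r : ℂ) ∈ disk := by
  simp [abs_of_nonneg h0, h1]

lemma fourier_one_pow (n : ℕ) (t : UnitAddCircle) : (fourier 1 t : ℂ) ^ n = fourier (n : ℤ) t := by
  induction n with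
  | zero => simp
  | succ n ih => rw [pow_succ, ih, Nat.cast_succ, fourier_add]

lemma norm_fourier (n : ℤ) (t : UnitAddCircle) : ‖(fourier n t : ℂ)‖ = 1 := by
  rw [fourier_apply, Circle.norm_coe]

lemma fourier_mul_conj (n : ℤ) (t : UnitAddCircle) : fourier n t * conj (fourier n t : ℂ) = 1 := by
  rw [Complex.mul_conj, Complex.normSq_eq_norm_sq, norm_fourier]; simp

lemma fourierCoeff_dilate {f : ℂ → ℂ} {a : ℕ → ℂ} (ha : HasTaylor f a) {r : ℝ}
    (h0 : 0 ≤ r) (h1 : r < 1) (k : ℤ) :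
    fourierCoeff (dilate f r) k = extendZero (fun n => a n * (r : ℂ) ^ n) k := by
  have hs : Summable fun n => ‖a n * (r : ℂ) ^ n‖ := (ha _ (ofReal_mem_disk h0 h1)).summable.norm
  have hF : ∀ n : ℕ, ∀ t : UnitAddCircle, ‖fourier (-k) t • (a n * (r * fourier 1 t) ^ n)‖
      = ‖a n * (r : ℂ) ^ n‖ := by
    intro n t
    rw [norm_smul, norm_fourier, mul_pow, ← mul_assoc, norm_mul _ ((fourier 1 t : ℂ) ^ n), norm_pow,
      norm_fourier]
    simp
  have key := hasSum_integral_of_summable_integral_norm (μ := m)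
    (F := fun (n : ℕ) (t : UnitAddCircle) => fourier (-k) t • (a n * (r * fourier 1 t) ^ n))
    (fun n => Continuous.integrable_of_hasCompactSupport (by fun_prop)
      (HasCompactSupport.of_compactSpace _))
    (by simp_rw [hF]; simpa using hs)
  have hterm : ∀ n : ℕ, ∫ t, fourier (-k) t • (a n * (r * fourier 1 t) ^ n) ∂m
      = a n * (r : ℂ) ^ n * (Pi.single (n : ℤ) 1 : ℤ → ℂ) k := by
    intro n
    rw [← fourierCoeff_fourier (T := 1) (n : ℤ), ← fourierCoeff.const_mul]
    simp only [fourierCoeff, mul_pow, fourier_one_pow, mul_assoc]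
  simp_rw [hterm] at key
  have hsum : ∫ t, ∑' n : ℕ, fourier (-k) t • (a n * (r * fourier 1 t) ^ n) ∂m
      = fourierCoeff (dilate f r) k := by
    refine integral_congr_ae (ae_of_all _ fun t => ?_)
    have := (ha _ (mem_disk_of_radius h0 h1 t)).const_smul (fourier (-k) t : ℂ)
    exact this.tsum_eq
  rw [hsum] at key
  refine key.unique ?_
  obtain n | n := k
  · have := hasSum_ite_eq n (a n * (r : ℂ) ^ n)
    refine this.congr_fun fun j => ?_
    by_cases h : j = n
    · subst h; simp
    · simp [h, Ne.symm h]
  · refine hasSum_zero.congr_fun fun j => ?_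
    simp

/-! ### Dilates as elements of `L²` -/

lemma memLp_of_continuous {g : UnitAddCircle → ℂ} (hg : Continuous g) (p : ℝ≥0∞) : MemLp g p m := by
  obtain ⟨C, hC⟩ := (isCompact_range hg).isBounded.exists_norm_le
  exact MemLp.of_bound hg.aestronglyMeasurable C (ae_of_all _ fun t => hC _ ⟨t, rfl⟩)

open Classical in
/-- The dilate of `f` as an element of `L²`. -/
def dilateLp (f : ℂ → ℂ) (r : ℝ) : L2 :=
  if h : MemLp (dilate f r) 2 m then h.toLp else 0

lemma coeFn_dilateLp {f : ℂ → ℂ} (hf : f ∈ Hol) {r : ℝ} (h0 : 0 ≤ r) (h1 : r < 1) :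
    dilateLp f r =ᵐ[m] dilate f r := by
  have h := memLp_of_continuous (dilate_continuous hf h0 h1) 2
  rw [dilateLp, dif_pos h]
  exact h.coeFn_toLp

lemma isBoundaryFunction_iff {f : ℂ → ℂ} (hf : f ∈ Hol) (F : L2) :
    IsBoundaryFunction f F ↔ Tendsto (dilateLp f) (𝓝[<] 1) (𝓝 F) := by
  rw [Lp.tendsto_Lp_iff_tendsto_eLpNorm', IsBoundaryFunction]
  refine tendsto_congr' ?_
  filter_upwards [eventually_radius] with r hr
  refine eLpNorm_congr_ae ?_
  filter_upwards [coeFn_dilateLp hf hr.1 hr.2] with t ht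
  simp [ht]

lemma norm_sq_eq_integral (F : L2) : ‖F‖ ^ 2 = ∫ t, ‖F t‖ ^ 2 ∂m := by
  have h := congr_arg RCLike.re (L2.inner_def (𝕜 := ℂ) F F)
  rw [← integral_re (L2.integrable_inner F F)] at h
  simpa only [← norm_sq_eq_re_inner] using h

lemma norm_sq_eq_tsum (F : L2) : ‖F‖ ^ 2 = ∑' k : ℤ, ‖fourierCoeff F k‖ ^ 2 := by
  rw [norm_sq_eq_integral, tsum_sq_fourierCoeff]

lemma norm_fourierCoeff_le (F : L2) (k : ℤ) : ‖fourierCoeff F k‖ ≤ ‖F‖ := by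
  have h := (hasSum_sq_fourierCoeff F).summable.le_tsum k (fun _ _ => by positivity)
  rw [← norm_sq_eq_tsum] at h
  exact (sq_le_sq₀ (norm_nonneg _) (norm_nonneg _)).1 h

lemma fourierCoeff_sub (F G : L2) (k : ℤ) :
    fourierCoeff (F - G : L2) k = fourierCoeff F k - fourierCoeff G k := by
  simp_rw [← fourierBasis_repr]; simp

lemma fourierCoeff_eq_inner (F : L2) (k : ℤ) :
    fourierCoeff F k = inner ℂ (fourierLp 2 k : L2) F := by
  rw [← fourierBasis_repr, fourierBasis.repr_apply_apply, coe_fourierBasis]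

lemma integral_norm_dilate {f : ℂ → ℂ} (hf : f ∈ Hol) {r : ℝ} (h0 : 0 ≤ r) (h1 : r < 1) :
    ∫ t, ‖dilate f r t‖ ^ 2 ∂m = ‖dilateLp f r‖ ^ 2 := by
  rw [norm_sq_eq_integral]
  refine integral_congr_ae ?_
  filter_upwards [coeFn_dilateLp hf h0 h1] with t ht
  rw [ht]

lemma mem_H2_iff {f : ℂ → ℂ} (hf : f ∈ Hol) :
    f ∈ H2 ↔ ∃ C : ℝ, ∀ r : ℝ, 0 ≤ r → r < 1 → ‖dilateLp f r‖ ^ 2 ≤ C := by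
  constructor
  · rintro ⟨-, C, hC⟩
    exact ⟨C, fun r h0 h1 => by rw [← integral_norm_dilate hf h0 h1]; exact hC r h0 h1⟩
  · rintro ⟨C, hC⟩
    exact ⟨hf, C, fun r h0 h1 => by rw [integral_norm_dilate hf h0 h1]; exact hC r h0 h1⟩

lemma fourierCoeff_dilateLp {f : ℂ → ℂ} (hf : f ∈ Hol) {a : ℕ → ℂ} (ha : HasTaylor f a) {r : ℝ}
    (h0 : 0 ≤ r) (h1 : r < 1) (k : ℤ) :
    fourierCoeff (dilateLp f r) k = extendZero (fun n => a n * (r : ℂ) ^ n) k := by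
  rw [fourierCoeff_congr_ae (coeFn_dilateLp hf h0 h1), fourierCoeff_dilate ha h0 h1]

lemma norm_extendZero_le {a : ℕ → ℂ} {r : ℝ} (h0 : 0 ≤ r) (h1 : r < 1) (k : ℤ) :
    ‖extendZero (fun n => a n * (r : ℂ) ^ n) k‖ ≤ ‖extendZero a k‖ := by
  obtain n | n := k
  · simp only [Int.ofNat_eq_natCast, extendZero_natCast, norm_mul, norm_pow, Complex.norm_real,
      Real.norm_eq_abs, abs_of_nonneg h0]
    exact mul_le_of_le_one_right (norm_nonneg _) (pow_le_one₀ h0 h1.le)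
  · simp

lemma tendsto_extendZero (a : ℕ → ℂ) (k : ℤ) :
    Tendsto (fun r : ℝ => extendZero (fun n => a n * (r : ℂ) ^ n) k) (𝓝[<] 1)
      (𝓝 (extendZero a k)) := by
  obtain n | n := k
  · simp only [Int.ofNat_eq_natCast, extendZero_natCast]
    have : Continuous fun r : ℝ => a n * (r : ℂ) ^ n := by fun_prop
    simpa using (this.tendsto 1).mono_left nhdsWithin_le_nhds
  · simp

/-- A holomorphic function whose Taylor coefficients are the Fourier coefficients of some
`F ∈ L²` belongs to `H²` and has boundary function `F`. -/
lemma isBoundaryFunction_of_fourierCoeff {f : ℂ → ℂ} (hf : f ∈ Hol) {a : ℕ → ℂ}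
    (ha : HasTaylor f a) {F : L2} (hF : ∀ k, fourierCoeff F k = extendZero a k) :
    f ∈ H2 ∧ IsBoundaryFunction f F := by
  have hsum : Summable fun k => ‖extendZero a k‖ ^ 2 := by
    simpa only [hF] using (hasSum_sq_fourierCoeff F).summable
  constructor
  · rw [mem_H2_iff hf]
    refine ⟨‖F‖ ^ 2, fun r h0 h1 => ?_⟩
    rw [norm_sq_eq_tsum, norm_sq_eq_tsum]
    refine Summable.tsum_le_tsum (fun k => ?_) (hasSum_sq_fourierCoeff _).summable
      (hasSum_sq_fourierCoeff _).summable
    rw [fourierCoeff_dilateLp hf ha h0 h1, hF]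
    gcongr
    exact norm_extendZero_le h0 h1 k
  · rw [isBoundaryFunction_iff hf, tendsto_iff_norm_sub_tendsto_zero]
    have key : Tendsto (fun r : ℝ => ∑' k : ℤ,
        ‖extendZero (fun n => a n * (r : ℂ) ^ n) k - extendZero a k‖ ^ 2) (𝓝[<] 1)
        (𝓝 (∑' _ : ℤ, 0)) := by
      -- The factor 4 is the square of 2: both terms of the difference are at most `‖extendZero a
      -- k‖` in norm.
      refine tendsto_tsum_of_dominated_convergence (hsum.mul_left 4) (fun k => ?_) ?_
      · have := (((tendsto_extendZero a k).sub_const (extendZero a k)).norm).pow 2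
        simpa using this
      · filter_upwards [eventually_radius] with r hr k
        rw [Real.norm_of_nonneg (by positivity)]
        have h1 := norm_extendZero_le (a := a) hr.1 hr.2 k
        have h2 := norm_sub_le (extendZero (fun n => a n * (r : ℂ) ^ n) k) (extendZero a k)
        calc _ ≤ (2 * ‖extendZero a k‖) ^ 2 := by gcongr; linarith
          _ = _ := by ring
    rw [tsum_zero] at key
    have h2 := (Real.continuous_sqrt.tendsto 0).comp key
    rw [Real.sqrt_zero] at h2
    refine h2.congr' ?_
    filter_upwards [eventually_radius] with r hr
    simp only [Function.comp_apply]
    rw [← Real.sqrt_sq (norm_nonneg (dilateLp f r - F)), norm_sq_eq_tsum]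
    congr 1
    refine tsum_congr fun k => ?_
    rw [fourierCoeff_sub, fourierCoeff_dilateLp hf ha hr.1 hr.2, hF]

lemma exists_fourierCoeff_eq {c : ℤ → ℂ} (hc : Summable fun k => ‖c k‖ ^ 2) :
    ∃ F : L2, ∀ k, fourierCoeff F k = c k := by
  have hmem : Memℓp c 2 := by
    rw [memℓp_gen_iff (by norm_num)]
    simpa using hc
  refine ⟨fourierBasis.repr.symm ⟨c, hmem⟩, fun k => ?_⟩
  rw [← fourierBasis_repr]
  simp

lemma isBoundaryFunction_unique {f : ℂ → ℂ} (hf : f ∈ Hol) {F G : L2}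
    (hF : IsBoundaryFunction f F) (hG : IsBoundaryFunction f G) : F = G := by
  rw [isBoundaryFunction_iff hf] at hF hG
  exact tendsto_nhds_unique hF hG

lemma bdry_eq {f : ℂ → ℂ} (hf : f ∈ Hol) {F : L2} (hF : IsBoundaryFunction f F) : bdry f = F :=
  isBoundaryFunction_unique hf (Classical.epsilon_spec ⟨F, hF⟩) hF

/-- Each finite sum is the limit, as r → 1, of partial Parseval sums of the dilates, all bounded by
the H² bound. -/
lemma summable_sq_extendZero {f : ℂ → ℂ} (hf : f ∈ H2) {a : ℕ → ℂ} (ha : HasTaylor f a) :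
    Summable fun k => ‖extendZero a k‖ ^ 2 := by
  obtain ⟨C, hC⟩ := (mem_H2_iff hf.1).1 hf
  refine summable_of_sum_le (c := C) (fun _ => by positivity) fun s => ?_
  have : Tendsto (fun r : ℝ => ∑ k ∈ s, ‖extendZero (fun n => a n * (r : ℂ) ^ n) k‖ ^ 2) (𝓝[<] 1)
      (𝓝 (∑ k ∈ s, ‖extendZero a k‖ ^ 2)) :=
    tendsto_finsetSum _ fun k _ => (tendsto_extendZero a k).norm.pow 2
  refine le_of_tendsto this ?_
  filter_upwards [eventually_radius] with r hr
  refine le_trans ?_ (hC r hr.1 hr.2)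
  rw [norm_sq_eq_tsum]
  simp_rw [← fourierCoeff_dilateLp hf.1 ha hr.1 hr.2]
  exact (hasSum_sq_fourierCoeff _).summable.sum_le_tsum s (fun _ _ => by positivity)

/-- Riesz–Fischer supplies an L² function with the Taylor coefficients of f, so the choice in `bdry`
is not vacuous. -/
lemma isBoundaryFunction_bdry {f : ℂ → ℂ} (hf : f ∈ H2) : IsBoundaryFunction f (bdry f) := by
  obtain ⟨a, ha⟩ := exists_hasTaylor hf.1
  obtain ⟨F, hF⟩ := exists_fourierCoeff_eq (summable_sq_extendZero hf ha)
  exact Classical.epsilon_spec ⟨F, (isBoundaryFunction_of_fourierCoeff hf.1 ha hF).2⟩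

lemma fourierCoeff_bdry {f : ℂ → ℂ} (hf : f ∈ H2) {a : ℕ → ℂ} (ha : HasTaylor f a) (k : ℤ) :
    fourierCoeff (bdry f) k = extendZero a k := by
  obtain ⟨F, hF⟩ := exists_fourierCoeff_eq (summable_sq_extendZero hf ha)
  rw [bdry_eq hf.1 (isBoundaryFunction_of_fourierCoeff hf.1 ha hF).2, hF]

lemma tendsto_dilateLp {f : ℂ → ℂ} (hf : f ∈ H2) :
    Tendsto (dilateLp f) (𝓝[<] 1) (𝓝 (bdry f)) :=
  (isBoundaryFunction_iff hf.1 _).1 (isBoundaryFunction_bdry hf)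

lemma mem_H2T_iff {F : L2} : F ∈ H2T ↔ ∀ n : ℕ, fourierCoeff F (Int.negSucc n) = 0 := by
  constructor
  · intro h n
    have hle : H2T ≤ (ℂ ∙ (fourierLp 2 (Int.negSucc n) : L2))ᗮ := by
      refine Submodule.topologicalClosure_minimal _ (Submodule.span_le.2 ?_)
        (Submodule.isClosed_orthogonal _)
      rintro _ ⟨k, rfl⟩
      rw [SetLike.mem_coe, Submodule.mem_orthogonal_singleton_iff_inner_right]
      exact orthonormal_fourier.2 (by simp)
    rw [fourierCoeff_eq_inner]
    exact Submodule.mem_orthogonal_singleton_iff_inner_right.1 (hle h)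
  · intro h
    refine (Submodule.isClosed_topologicalClosure _).mem_of_tendsto (hasSum_fourier_series_L2 F)
      (Eventually.of_forall fun s => ?_)
    refine Submodule.le_topologicalClosure _ (Submodule.sum_mem _ fun k _ => ?_)
    obtain n | n := k
    · exact Submodule.smul_mem _ _ (Submodule.subset_span ⟨n, rfl⟩)
    · simp [h n]

lemma bdry_mem_H2T {f : ℂ → ℂ} (hf : f ∈ H2) : bdry f ∈ H2T := by
  obtain ⟨a, ha⟩ := exists_hasTaylor hf.1
  exact mem_H2T_iff.2 fun n => by rw [fourierCoeff_bdry hf ha, extendZero_negSucc]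

/-- A function orthogonal to all `z ^ n`, `n ≥ 0`, is orthogonal to `H²`. -/
lemma inner_eq_zero_of_fourierCoeff {F W : L2} (hF : F ∈ H2T)
    (hW : ∀ n : ℕ, fourierCoeff W n = 0) : inner ℂ F W = 0 := by
  have hle : H2T ≤ (ℂ ∙ W)ᗮ := by
    refine Submodule.topologicalClosure_minimal _ (Submodule.span_le.2 ?_)
      (Submodule.isClosed_orthogonal _)
    rintro _ ⟨k, rfl⟩
    rw [SetLike.mem_coe, Submodule.mem_orthogonal_singleton_iff_inner_left,
      ← fourierCoeff_eq_inner, hW]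
  exact Submodule.mem_orthogonal_singleton_iff_inner_left.1 (hle hF)

/-- Every element of `H2T` is the boundary function of a function in `H²`. -/
lemma exists_bdry_eq {F : L2} (hF : F ∈ H2T) : ∃ f ∈ H2, bdry f = F := by
  set a : ℕ → ℂ := fun n => fourierCoeff F n with ha
  have hbound : ∀ n, ‖a n‖ ≤ ‖F‖ := fun n => norm_fourierCoeff_le F n
  have hT : HasTaylor (fun z => ∑' n, a n * z ^ n) a := by
    intro z hz
    have hz' : ‖z‖ < 1 := by simpa using hz
    refine Summable.hasSum (Summable.of_norm_bounded
      ((summable_geometric_of_lt_one (norm_nonneg z) hz').mul_left ‖F‖) fun n => ?_)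
    rw [norm_mul, norm_pow]
    gcongr
    exact hbound n
  have hol : (fun z => ∑' n, a n * z ^ n) ∈ Hol := by
    refine fun z hz => DifferentiableAt.differentiableWithinAt ?_
    have hz' : ‖z‖ < 1 := by simpa using hz
    -- The geometric majorant is uniform only on smaller disks, so holomorphy is proved on a disk of
    -- radius ρ < 1 around 0 containing z.
    obtain ⟨ρ, hρ, hρ1⟩ := exists_between hz'
    have hd : DifferentiableOn ℂ (fun z => ∑' n, a n * z ^ n) (Metric.ball 0 ρ) := by
      refine Complex.differentiableOn_tsum_of_summable_norm (u := fun n => ‖F‖ * ρ ^ n)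
        ((summable_geometric_of_lt_one ((norm_nonneg z).trans hρ.le) hρ1).mul_left ‖F‖)
        (fun n => by fun_prop) Metric.isOpen_ball fun n w hw => ?_
      rw [norm_mul, norm_pow]
      have hw' : ‖w‖ < ρ := by simpa using hw
      gcongr
      exact hbound n
    exact hd.differentiableAt (Metric.isOpen_ball.mem_nhds (by simpa using hρ))
  have := isBoundaryFunction_of_fourierCoeff hol hT (F := F) (by
    rintro (n | n)
    · rfl
    · exact mem_H2T_iff.1 hF n)
  exact ⟨_, this.1, bdry_eq hol this.2⟩

/-- Point evaluations are bounded on `H²`. -/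
lemma norm_apply_le {f : ℂ → ℂ} (hf : f ∈ H2) {z : ℂ} (hz : z ∈ disk) :
    ‖f z‖ ≤ (1 - ‖z‖)⁻¹ * ‖bdry f‖ := by
  obtain ⟨a, ha⟩ := exists_hasTaylor hf.1
  have hz' : ‖z‖ < 1 := by simpa using hz
  have hg := (hasSum_geometric_of_lt_one (norm_nonneg z) hz').mul_right ‖bdry f‖
  rw [← (ha z hz).tsum_eq]
  refine tsum_of_norm_bounded hg fun n => ?_
  rw [norm_mul, norm_pow, mul_comm]
  gcongr
  have := norm_fourierCoeff_le (bdry f) n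
  rwa [fourierCoeff_bdry hf ha] at this

/-! ### Products -/

/-- The product `L² × L² → L¹`. -/
def mulL1 : L2 →L[ℂ] L2 →L[ℂ] Lp ℂ 1 m := (ContinuousLinearMap.mul ℂ ℂ).holderL m 2 2 1

lemma coeFn_mulL1 (F G : L2) : mulL1 F G =ᵐ[m] fun t => F t * G t :=
  (ContinuousLinearMap.mul ℂ ℂ).coeFn_holder F G

/-- Multiplication by the constant 1 serves as the continuous injection of L² into L¹, which lets L²
and L¹ limits be compared. -/
lemma coeFn_mulL1_one (F : L2) : mulL1 (fourierLp 2 0) F =ᵐ[m] F := by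
  filter_upwards [coeFn_mulL1 (fourierLp 2 0) F, coeFn_fourierLp (T := 1) 2 0] with t h1 h2
  rw [h1, h2, fourier_zero, one_mul]

lemma tendsto_mulL1 {ι : Type*} {l : Filter ι} {F G : ι → L2} {F₀ G₀ : L2}
    (hF : Tendsto F l (𝓝 F₀)) (hG : Tendsto G l (𝓝 G₀)) :
    Tendsto (fun i => mulL1 (F i) (G i)) l (𝓝 (mulL1 F₀ G₀)) :=
  ((isBoundedBilinearMap_apply (𝕜 := ℂ)).continuous.tendsto (mulL1 F₀, G₀)).comp
    (((mulL1.continuous.tendsto F₀).comp hF).prodMk_nhds hG)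

lemma continuous_fourierCoeff_L1 (k : ℤ) : Continuous fun G : Lp ℂ 1 m => fourierCoeff G k := by
  have : (fun G : Lp ℂ 1 m => fourierCoeff G k) = fun G : Lp ℂ 1 m =>
      (ContinuousLinearMap.mul ℂ ℂ).lpPairing m ∞ 1 (fourierLp ∞ (-k)) G := by
    funext G
    rw [ContinuousLinearMap.lpPairing_eq_integral]
    refine integral_congr_ae ?_
    filter_upwards [coeFn_fourierLp (T := 1) ∞ (-k)] with t ht
    rw [ht]; rfl
  rw [this]
  exact ContinuousLinearMap.continuous _

lemma Hol.mul {f g : ℂ → ℂ} (hf : f ∈ Hol) (hg : g ∈ Hol) : (fun z => f z * g z) ∈ Hol :=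
  DifferentiableOn.mul hf hg

lemma mulL1_dilateLp {f g : ℂ → ℂ} (hf : f ∈ Hol) (hg : g ∈ Hol) {r : ℝ} (h0 : 0 ≤ r)
    (h1 : r < 1) :
    mulL1 (dilateLp f r) (dilateLp g r) =ᵐ[m] dilate (fun z => f z * g z) r := by
  filter_upwards [coeFn_mulL1 (dilateLp f r) (dilateLp g r), coeFn_dilateLp hf h0 h1,
    coeFn_dilateLp hg h0 h1] with t a b c
  rw [a, b, c]; rfl

/-- The products of the dilates are the dilates of the product; they tend in L¹ both to the product
of the boundary functions and to the boundary function of the product. -/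
lemma bdry_mul {f g : ℂ → ℂ} (hf : f ∈ H2) (hg : g ∈ H2) (hfg : (fun z => f z * g z) ∈ H2) :
    bdry (fun z => f z * g z) =ᵐ[m] fun t => bdry f t * bdry g t := by
  have h1 := tendsto_mulL1 (tendsto_dilateLp hf) (tendsto_dilateLp hg)
  have h2 := tendsto_mulL1 (tendsto_const_nhds (x := (fourierLp 2 0 : L2))) (tendsto_dilateLp hfg)
  have h3 : mulL1 (bdry f) (bdry g) = mulL1 (fourierLp 2 0) (bdry fun z => f z * g z) := by
    refine tendsto_nhds_unique (h1.congr' ?_) h2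
    filter_upwards [eventually_radius] with r hr
    refine Lp.ext ?_
    filter_upwards [mulL1_dilateLp hf.1 hg.1 hr.1 hr.2, coeFn_mulL1_one
      (dilateLp (fun z => f z * g z) r), coeFn_dilateLp hfg.1 hr.1 hr.2] with t a b c
    rw [a, b, c]
  filter_upwards [coeFn_mulL1 (bdry f) (bdry g), coeFn_mulL1_one (bdry fun z => f z * g z)]
    with t a b
  rw [← a, ← b, h3]

/-- If the product of the boundary functions of `f, g ∈ H²` is in `L²`, then `f g ∈ H²`. -/
lemma mul_mem_H2 {f g : ℂ → ℂ} (hf : f ∈ H2) (hg : g ∈ H2) {P : L2}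
    (hP : P =ᵐ[m] fun t => bdry f t * bdry g t) :
    (fun z => f z * g z) ∈ H2 ∧ bdry (fun z => f z * g z) = P := by
  have hol := Hol.mul hf.1 hg.1
  obtain ⟨a, ha⟩ := exists_hasTaylor hol
  have h1 := tendsto_mulL1 (tendsto_dilateLp hf) (tendsto_dilateLp hg)
  -- Fourier coefficients are continuous on L¹, so those of the dilates of f g pass to the limit: P
  -- has the Taylor coefficients of f g.
  have key : ∀ k, fourierCoeff P k = extendZero a k := by
    intro k
    have h2 := ((continuous_fourierCoeff_L1 k).tendsto _).comp h1
    rw [fourierCoeff_congr_ae ((coeFn_mulL1 (bdry f) (bdry g)).trans hP.symm)] at h2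
    refine tendsto_nhds_unique (h2.congr' ?_) (tendsto_extendZero a k)
    filter_upwards [eventually_radius] with r hr
    simp only [Function.comp_apply]
    rw [fourierCoeff_congr_ae (mulL1_dilateLp hf.1 hg.1 hr.1 hr.2),
      fourierCoeff_dilate ha hr.1 hr.2]
  have := isBoundaryFunction_of_fourierCoeff hol ha key
  exact ⟨this.1, bdry_eq hol this.2⟩

/-! ### Bounded functions -/

lemma const_mem_Hinfty (c : ℂ) : (fun _ => c) ∈ Hinfty :=
  ⟨differentiableOn_const c, ‖c‖, fun _ _ => le_rfl⟩

lemma Hinfty.mul {f g : ℂ → ℂ} (hf : f ∈ Hinfty) (hg : g ∈ Hinfty) :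
    (fun z => f z * g z) ∈ Hinfty := by
  obtain ⟨hf, C, hC⟩ := hf
  obtain ⟨hg, D, hD⟩ := hg
  refine ⟨Hol.mul hf hg, C * D, fun z hz => ?_⟩
  rw [norm_mul]
  exact mul_le_mul (hC z hz) (hD z hz) (norm_nonneg _) ((norm_nonneg _).trans (hC z hz))

lemma pow_mem_Hinfty (n : ℕ) : (fun z : ℂ => z ^ n) ∈ Hinfty := by
  refine ⟨(differentiable_id.pow n).differentiableOn, 1, fun z hz => ?_⟩
  rw [norm_pow]
  exact pow_le_one₀ (norm_nonneg _) (by simpa using (Metric.mem_ball.1 hz).le)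

lemma norm_dilateLp_mul_le {h f : ℂ → ℂ} (hh : h ∈ Hol) {C : ℝ} (hC : ∀ z ∈ disk, ‖h z‖ ≤ C)
    (hf : f ∈ Hol) {r : ℝ} (h0 : 0 ≤ r) (h1 : r < 1) :
    ‖dilateLp (fun z => h z * f z) r‖ ≤ C * ‖dilateLp f r‖ := by
  refine Lp.norm_le_mul_norm_of_ae_le_mul ?_
  filter_upwards [coeFn_dilateLp (Hol.mul hh hf) h0 h1, coeFn_dilateLp hf h0 h1] with t a b
  rw [a, b]
  simp only [dilate, norm_mul]
  gcongr
  exact hC _ (mem_disk_of_radius h0 h1 t)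

lemma Hinfty.mul_mem_H2 {h f : ℂ → ℂ} (hh : h ∈ Hinfty) (hf : f ∈ H2) :
    (fun z => h z * f z) ∈ H2 := by
  obtain ⟨hh, C, hC⟩ := hh
  obtain ⟨D, hD⟩ := (mem_H2_iff hf.1).1 hf
  refine (mem_H2_iff (Hol.mul hh hf.1)).2 ⟨C ^ 2 * D, fun r h0 h1 => ?_⟩
  have := norm_dilateLp_mul_le hh hC hf.1 h0 h1
  calc _ ≤ (C * ‖dilateLp f r‖) ^ 2 := by gcongr
    _ = C ^ 2 * ‖dilateLp f r‖ ^ 2 := by ring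
    _ ≤ _ := by gcongr; exact hD r h0 h1

lemma Hinfty.mul_mem_H2' {h f : ℂ → ℂ} (hh : h ∈ Hinfty) (hf : f ∈ H2) :
    (fun z => f z * h z) ∈ H2 := by
  simpa only [mul_comm] using Hinfty.mul_mem_H2 hh hf

lemma one_mem_H2 : (fun _ => 1 : ℂ → ℂ) ∈ H2 :=
  ⟨differentiableOn_const _, 1, fun r _ _ => by simp [dilate]⟩

lemma Hinfty.mem_H2 {h : ℂ → ℂ} (hh : h ∈ Hinfty) : h ∈ H2 := by
  simpa using Hinfty.mul_mem_H2 hh one_mem_H2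

lemma norm_bdry_mul_le {h f : ℂ → ℂ} (hh : h ∈ Hol) {C : ℝ} (hC : ∀ z ∈ disk, ‖h z‖ ≤ C)
    (hf : f ∈ H2) : ‖bdry (fun z => h z * f z)‖ ≤ C * ‖bdry f‖ := by
  have hhf := Hinfty.mul_mem_H2 ⟨hh, C, hC⟩ hf
  refine le_of_tendsto_of_tendsto (tendsto_dilateLp hhf).norm
    ((tendsto_dilateLp hf).norm.const_mul C) ?_
  filter_upwards [eventually_radius] with r hr
  exact norm_dilateLp_mul_le hh hC hf.1 hr.1 hr.2

lemma norm_bdry_le {h : ℂ → ℂ} (hh : h ∈ Hol) {C : ℝ} (hC : ∀ z ∈ disk, ‖h z‖ ≤ C) :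
    ∀ᵐ t ∂m, ‖bdry h t‖ ≤ C := by
  have hb := (tendstoInMeasure_of_tendsto_Lp (tendsto_dilateLp (Hinfty.mem_H2 ⟨hh, C, hC⟩)))
  obtain ⟨s, hs, hlim⟩ := hb.exists_seq_tendsto_ae'
  obtain ⟨N, hN⟩ := eventually_atTop.1 (hs.eventually eventually_radius)
  -- `dilateLp` agrees with the pointwise dilate only a.e.; along a sequence of radii one null set
  -- suffices.
  have hall : ∀ᵐ t ∂m, ∀ n, N ≤ n → dilateLp h (s n) t = dilate h (s n) t := by
    refine ae_all_iff.2 fun n => ?_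
    by_cases hn : N ≤ n
    · filter_upwards [coeFn_dilateLp hh (hN n hn).1 (hN n hn).2] with t ht _ using ht
    · exact ae_of_all _ fun t h => absurd h hn
  filter_upwards [hlim, hall] with t ht ht'
  refine le_of_tendsto ht.norm (eventually_atTop.2 ⟨N, fun n hn => ?_⟩)
  rw [ht' n hn]
  exact norm_dilate_le hC (hN n hn).1 (hN n hn).2 t

lemma bdry_pow (n : ℕ) : bdry (fun z => z ^ n) = fourierLp 2 (n : ℤ) := by
  have hT : HasTaylor (fun z => z ^ n) (Pi.single n 1) := by
    intro z _
    refine (hasSum_ite_eq n (z ^ n)).congr_fun fun j => ?_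
    by_cases h : j = n
    · subst h; simp
    · simp [h]
  refine bdry_eq (pow_mem_Hinfty n).1 (isBoundaryFunction_of_fourierCoeff (pow_mem_Hinfty n).1 hT
    fun k => ?_).2
  rw [fourierCoeff_congr_ae (coeFn_fourierLp 2 _), fourierCoeff_fourier]
  obtain j | j := k
  · by_cases h : j = n
    · subst h; simp
    · simp [h]
  · simp

lemma coeFn_bdry_pow (n : ℕ) : bdry (fun z => z ^ n) =ᵐ[m] fourier (n : ℤ) := by
  rw [bdry_pow]; exact coeFn_fourierLp 2 _

lemma affine_mem_Hinfty {u : ℂ → ℂ} (hu : u ∈ Hinfty) (c d : ℂ) :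
    (fun z => c + d * u z) ∈ Hinfty := by
  obtain ⟨hu, C, hC⟩ := hu
  refine ⟨DifferentiableOn.const_add c (DifferentiableOn.const_mul hu d), ‖c‖ + ‖d‖ * C,
    fun z hz => (norm_add_le _ _).trans ?_⟩
  rw [norm_mul]
  gcongr
  exact hC z hz

lemma bdry_affine {u : ℂ → ℂ} (hu : u ∈ Hinfty) (c d : ℂ) :
    bdry (fun z => c + d * u z) =ᵐ[m] fun t => c + d * bdry u t := by
  have hb : bdry (fun z => c + d * u z) = c • fourierLp 2 0 + d • bdry u := by
    refine bdry_eq (affine_mem_Hinfty hu c d).1 ((isBoundaryFunction_iff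
      (affine_mem_Hinfty hu c d).1 _).2 ?_)
    refine (((tendsto_dilateLp (Hinfty.mem_H2 hu)).const_smul d).const_add (c • fourierLp 2 0)).congr' ?_
    filter_upwards [eventually_radius] with r hr
    refine Lp.ext ?_
    filter_upwards [coeFn_dilateLp hu.1 hr.1 hr.2,
      coeFn_dilateLp (affine_mem_Hinfty hu c d).1 hr.1 hr.2,
      Lp.coeFn_add (c • fourierLp 2 0 : L2) (d • dilateLp u r),
      Lp.coeFn_smul c (fourierLp 2 0 : L2), Lp.coeFn_smul d (dilateLp u r),
      coeFn_fourierLp (T := 1) 2 0] with t a b e f g i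
    rw [e, Pi.add_apply, f, g, Pi.smul_apply, Pi.smul_apply, i, a, b, fourier_zero]
    simp [dilate]
  rw [hb]
  filter_upwards [Lp.coeFn_add (c • fourierLp 2 0 : L2) (d • bdry u),
    Lp.coeFn_smul c (fourierLp 2 0 : L2), Lp.coeFn_smul d (bdry u),
    coeFn_fourierLp (T := 1) 2 0] with t e f g i
  rw [e, Pi.add_apply, f, g, Pi.smul_apply, Pi.smul_apply, i, fourier_zero]
  simp

/-- A function in `H²` whose boundary function is bounded by `C` is bounded by `C` on the disk. -/
lemma norm_le_of_norm_bdry_le {f : ℂ → ℂ} (hf : f ∈ H2) {C : ℝ} (hC0 : 0 ≤ C)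
    (hC : ∀ᵐ t ∂m, ‖bdry f t‖ ≤ C) {z : ℂ} (hz : z ∈ disk) : ‖f z‖ ≤ C := by
  -- Power trick: point evaluation applied to f^n gives |f(z)|^n ≤ (1 - |z|)⁻¹ C^n, and the constant
  -- disappears as n → ∞.
  have hpow : ∀ n : ℕ, (fun z => f z ^ n) ∈ H2 ∧ ∀ᵐ t ∂m, ‖bdry (fun z => f z ^ n) t‖ ≤ C ^ n := by
    intro n
    induction n with
    | zero =>
      simp only [pow_zero]
      exact ⟨one_mem_H2, norm_bdry_le (const_mem_Hinfty 1).1 (by simp)⟩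
    | succ n ih =>
      have hb : ∀ᵐ t ∂m, ‖bdry (fun z => f z ^ n) t * bdry f t‖ ≤ C ^ (n + 1) := by
        filter_upwards [ih.2, hC] with t h1 h2
        rw [norm_mul, pow_succ]
        gcongr
      have hP : MemLp (fun t => bdry (fun z => f z ^ n) t * bdry f t) 2 m :=
        MemLp.of_bound ((Lp.aestronglyMeasurable _).mul (Lp.aestronglyMeasurable _)) _ hb
      have := mul_mem_H2 ih.1 hf hP.coeFn_toLp
      simp only [pow_succ]
      refine ⟨this.1, ?_⟩
      rw [this.2]
      filter_upwards [hP.coeFn_toLp, hb] with t h1 h2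
      rwa [h1, ← pow_succ]
  have hle : ∀ n : ℕ, ‖f z‖ ^ n ≤ (1 - ‖z‖)⁻¹ * C ^ n := by
    intro n
    have h1 := norm_apply_le (hpow n).1 hz
    rw [norm_pow] at h1
    refine h1.trans ?_
    have hz' : ‖z‖ < 1 := by simpa using hz
    have : 0 ≤ (1 - ‖z‖)⁻¹ := inv_nonneg.2 (by linarith)
    gcongr
    have := Lp.norm_le_of_ae_bound (pow_nonneg hC0 n) (hpow n).2
    simpa [measureUnivNNReal] using this
  by_contra! hlt
  have hpos : 0 < ‖f z‖ := hC0.trans_lt hlt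
  have ht : Tendsto (fun n : ℕ => (1 - ‖z‖)⁻¹ * (C / ‖f z‖) ^ n) atTop (𝓝 ((1 - ‖z‖)⁻¹ * 0)) :=
    (tendsto_pow_atTop_nhds_zero_of_lt_one (by positivity)
      ((div_lt_one hpos).2 hlt)).const_mul _
  have : (1 : ℝ) ≤ (1 - ‖z‖)⁻¹ * 0 := by
    refine ge_of_tendsto' ht fun n => ?_
    rw [div_pow, ← mul_div_assoc, le_div_iff₀ (by positivity), one_mul]
    exact hle n
  norm_num at this

/-! ### Orthogonality to `H²` in terms of Fourier coefficients -/

lemma inner_eq_integral (F G : L2) : inner ℂ F G = ∫ t, conj (F t) * G t ∂m := by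
  rw [L2.inner_def]
  simp only [RCLike.inner_apply']

lemma fourierCoeff_eq_integral (W : UnitAddCircle → ℂ) (k : ℤ) :
    fourierCoeff W k = ∫ t, conj (fourier k t : ℂ) * W t ∂m := by
  simp only [fourierCoeff, fourier_neg, smul_eq_mul]

lemma integral_conj_mul_eq_zero {F : L2} (hF : F ∈ H2T) {W : UnitAddCircle → ℂ}
    (hW : MemLp W 2 m) (h : ∀ n : ℕ, fourierCoeff W n = 0) : ∫ t, conj (F t) * W t ∂m = 0 := by
  rw [← inner_eq_zero_of_fourierCoeff (W := hW.toLp) hF fun n => by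
    rw [fourierCoeff_congr_ae hW.coeFn_toLp, h], inner_eq_integral]
  refine integral_congr_ae ?_
  filter_upwards [hW.coeFn_toLp] with t ht
  rw [ht]

lemma memLp_conj_mul {b W : UnitAddCircle → ℂ} (hb : AEStronglyMeasurable b m) {C : ℝ}
    (hC : ∀ᵐ t ∂m, ‖b t‖ ≤ C) (hW : MemLp W 2 m) : MemLp (fun t => conj (b t) * W t) 2 m := by
  refine hW.of_le_mul (c := C)
    ((Complex.continuous_conj.comp_aestronglyMeasurable hb).mul hW.1) ?_
  filter_upwards [hC] with t ht
  rw [norm_mul, RCLike.norm_conj]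
  gcongr

/-- Multiplication by `conj h` with `h ∈ H^∞` preserves the orthogonal complement of `H²`. -/
lemma fourierCoeff_conj_mul {h : ℂ → ℂ} (hh : h ∈ Hinfty) {W : UnitAddCircle → ℂ}
    (hW : MemLp W 2 m) (hW0 : ∀ n : ℕ, fourierCoeff W n = 0) (n : ℕ) :
    fourierCoeff (fun t => conj (bdry h t) * W t) n = 0 := by
  have hn := Hinfty.mem_H2 (pow_mem_Hinfty n)
  have hm := Hinfty.mul_mem_H2 hh hn
  rw [fourierCoeff_eq_integral, ← integral_conj_mul_eq_zero (bdry_mem_H2T hm) hW hW0]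
  refine integral_congr_ae ?_
  filter_upwards [bdry_mul (Hinfty.mem_H2 hh) hn hm, coeFn_bdry_pow n] with t h1 h2
  rw [h1, h2, map_mul]
  ring

lemma conj_mul_self_of_norm_eq_one {w : ℂ} (hw : ‖w‖ = 1) : conj w * w = 1 := by
  rw [mul_comm, Complex.mul_conj, Complex.normSq_eq_norm_sq, hw]
  simp

lemma IsInner.memLp_conj_mul {u : ℂ → ℂ} (hu : IsInner u) (F : L2) :
    MemLp (fun t => conj (bdry u t) * F t) 2 m :=
  ModelSpace.memLp_conj_mul (Lp.aestronglyMeasurable _)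
    (C := 1) (by filter_upwards [hu.norm_bdry] with t ht using ht.le) (Lp.memLp F)

/-- Moving Θ across the inner product turns orthogonality of f to Θ h into orthogonality of conj(Θ)
f to h, and testing on h = z^n is enough. -/
lemma mem_K_iff {Θ f : ℂ → ℂ} (hΘ : IsInner Θ) :
    f ∈ K Θ ↔ f ∈ H2 ∧ ∀ n : ℕ, fourierCoeff (fun t => conj (bdry Θ t) * bdry f t) n = 0 := by
  have key : ∀ h ∈ H2, inner ℂ (bdry (fun z => Θ z * h z)) (bdry f)
      = ∫ t, conj (bdry h t) * (conj (bdry Θ t) * bdry f t) ∂m := by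
    intro h hh
    rw [inner_eq_integral]
    refine integral_congr_ae ?_
    filter_upwards [bdry_mul (Hinfty.mem_H2 hΘ.1) hh (Hinfty.mul_mem_H2 hΘ.1 hh)] with t ht
    rw [ht, map_mul]
    ring
  refine and_congr_right fun hf => ⟨fun H n => ?_, fun H h hh => ?_⟩
  · have hn := Hinfty.mem_H2 (pow_mem_Hinfty n)
    rw [fourierCoeff_eq_integral, ← H _ hn, key _ hn]
    refine integral_congr_ae ?_
    filter_upwards [coeFn_bdry_pow n] with t ht
    rw [ht]
  · rw [key h hh]
    exact integral_conj_mul_eq_zero (bdry_mem_H2T hh) (hΘ.memLp_conj_mul _) H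

/-! ### The symbol and the kernel of its Toeplitz operator -/

/-- The function `\overline{z v} u φ` on the circle. -/
def twist (u v φ : ℂ → ℂ) (t : UnitAddCircle) : ℂ :=
  conj (fourier 1 t * bdry v t) * bdry u t * bdry φ t

lemma memLp_twist {u v : ℂ → ℂ} (hu : IsInner u) (hv : IsInner v) (φ : ℂ → ℂ) :
    MemLp (twist u v φ) 2 m := by
  refine (Lp.memLp (bdry φ)).of_le_mul (c := 1)
    ((memLp_symbol hu hv).1.mul (Lp.aestronglyMeasurable _)) ?_
  filter_upwards [hu.norm_bdry, hv.norm_bdry] with t h1 h2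
  rw [twist, norm_mul, norm_mul, RCLike.norm_conj, norm_mul, norm_fourier, h1, h2]
  simp

lemma coeFn_mulOp_symbol {u v : ℂ → ℂ} (hu : IsInner u) (hv : IsInner v) (φ : ℂ → ℂ) :
    mulOp (symbol hu hv) (bdry φ) =ᵐ[m] twist u v φ := by
  have h : mulOp (symbol hu hv) (bdry φ) =ᵐ[m] fun t => symbol hu hv t * bdry φ t :=
    (ContinuousLinearMap.mul ℂ ℂ).coeFn_holder (r := 2) (symbol hu hv) (bdry φ)
  filter_upwards [h, (memLp_symbol hu hv).coeFn_toLp] with t h1 h2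
  rw [h1, symbol, h2, twist]

lemma toeplitz_eq_zero_iff (g : Lp ℂ ∞ m) (F : H2T) :
    toeplitz g F = 0 ↔ mulOp g F ∈ H2Tᗮ := by
  rw [toeplitz, ContinuousLinearMap.comp_apply, ContinuousLinearMap.comp_apply,
    Submodule.orthogonalProjectionOnto_eq_zero_iff, Submodule.subtypeL_apply]

lemma mem_orthogonal_H2T_iff (W : L2) : W ∈ H2Tᗮ ↔ ∀ n : ℕ, fourierCoeff W n = 0 := by
  constructor
  · intro h n
    rw [fourierCoeff_eq_inner]
    exact (Submodule.mem_orthogonal _ _).1 h _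
      (Submodule.le_topologicalClosure _ (Submodule.subset_span ⟨n, rfl⟩))
  · exact fun h => (Submodule.mem_orthogonal _ _).2 fun F hF => inner_eq_zero_of_fourierCoeff hF h

lemma mem_kerToeplitz_iff {u v φ : ℂ → ℂ} (hu : IsInner u) (hv : IsInner v) :
    φ ∈ kerToeplitz (symbol hu hv) ↔
      φ ∈ H2 ∧ ∀ n : ℕ, fourierCoeff (twist u v φ) n = 0 := by
  rw [kerToeplitz, Set.mem_ofPred_eq]
  refine and_congr_right fun hφ => ?_
  simp_rw [toeplitz_eq_zero_iff, mem_orthogonal_H2T_iff,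
    fourierCoeff_congr_ae (coeFn_mulOp_symbol hu hv φ)]
  exact exists_prop_of_true (bdry_mem_H2T hφ)

/-! ### Inner functions and the backward shift -/

lemma IsInner.norm_le_one {u : ℂ → ℂ} (hu : IsInner u) {z : ℂ} (hz : z ∈ disk) : ‖u z‖ ≤ 1 :=
  norm_le_of_norm_bdry_le (Hinfty.mem_H2 hu.1) zero_le_one
    (by filter_upwards [hu.norm_bdry] with t ht using ht.le) hz

/-- Maximum principle: |u| ≤ 1 on the disk, and equality at 0 would force u to be constant. -/
lemma IsInner.norm_zero_lt_one {u : ℂ → ℂ} (hu : IsInner u)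
    (hc : ¬ ∃ c : ℂ, ∀ z ∈ disk, u z = c) : ‖u 0‖ < 1 := by
  have h0 : (0 : ℂ) ∈ disk := by simp
  refine lt_of_le_of_ne (hu.norm_le_one h0) fun h => hc ⟨u 0, ?_⟩
  refine Complex.eqOn_of_isPreconnected_of_isMaxOn_norm (convex_ball _ _).isPreconnected
    Metric.isOpen_ball hu.1.1 h0 fun z hz => ?_
  simpa [h] using hu.norm_le_one hz

lemma backwardShift_mem_Hinfty {u : ℂ → ℂ} (hu : u ∈ Hinfty) : backwardShift u ∈ Hinfty := by
  obtain ⟨hol, C, hC⟩ := hu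
  have hd : DifferentiableOn ℂ (dslope u 0) disk :=
    (Complex.differentiableOn_dslope (Metric.isOpen_ball.mem_nhds (by simp))).2 hol
  have h0 : (0 : ℂ) ∈ disk := by simp
  -- Compactness bounds the slope for |z| ≤ 1/2; elsewhere it is at most 2C / (1/2) = 4C.
  obtain ⟨D, hD⟩ := ((isCompact_closedBall (0 : ℂ) (1 / 2)).image_of_continuousOn
    (hd.continuousOn.mono (Metric.closedBall_subset_ball (by norm_num)))).isBounded.exists_norm_le
  refine ⟨hd, max D (4 * C), fun z hz => ?_⟩
  by_cases hz2 : ‖z‖ ≤ 1 / 2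
  · exact (hD _ ⟨z, by simpa using hz2, rfl⟩).trans (le_max_left _ _)
  · refine le_trans ?_ (le_max_right _ _)
    push Not at hz2
    have hz0 : z ≠ 0 := by rintro rfl; norm_num at hz2
    rw [backwardShift, dslope_of_ne _ hz0, slope_def_field, norm_div, sub_zero,
      div_le_iff₀ (by positivity)]
    have h1 := norm_sub_le (u z) (u 0)
    have h2 := hC z hz
    have h3 := hC 0 h0
    have h4 : 0 ≤ C := (norm_nonneg _).trans h3
    nlinarith

/-- Take boundary values in z S^*u = u - u(0) and multiply by conj(z). -/
lemma bdry_backwardShift {u : ℂ → ℂ} (hu : u ∈ Hinfty) :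
    ∀ᵐ t ∂m, bdry (backwardShift u) t = conj (fourier 1 t : ℂ) * (bdry u t - u 0) := by
  have hz := Hinfty.mem_H2 (pow_mem_Hinfty 1)
  have hS := backwardShift_mem_Hinfty hu
  have heq : (fun z => z ^ 1 * backwardShift u z) = fun z => -u 0 + 1 * u z := by
    funext z
    have := sub_smul_dslope u 0 z
    simp only [sub_zero, smul_eq_mul] at this
    rw [pow_one, backwardShift, this]
    ring
  have h1 := bdry_mul hz (Hinfty.mem_H2 hS) (Hinfty.mul_mem_H2' hS hz)
  rw [heq] at h1
  filter_upwards [h1, bdry_affine hu (-u 0) 1, coeFn_bdry_pow 1] with t a b c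
  rw [b, c, Nat.cast_one] at a
  have := fourier_mul_conj 1 t
  linear_combination (-conj (fourier 1 t : ℂ)) * a - bdry (backwardShift u) t * this

/-- For `φ ∈ H²`, `φ S^* u ∈ 𝒦_v` if and only if `\overline{z v} u φ` is orthogonal to `H²`. -/
lemma mul_backwardShift_mem_K_iff {u v φ : ℂ → ℂ} (hu : IsInner u) (hv : IsInner v)
    (hc : ¬ ∃ c : ℂ, ∀ z ∈ disk, u z = c) (hφ : φ ∈ H2) :
    (fun z => φ z * backwardShift u z) ∈ K v ↔
      ∀ n : ℕ, fourierCoeff (twist u v φ) n = 0 := by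
  have hS := backwardShift_mem_Hinfty hu.1
  have hm := Hinfty.mul_mem_H2' hS hφ
  have hlt := hu.norm_zero_lt_one hc
  -- This q is the factor that separates conj(v) φ S^*u from W; it is bounded below by 1 - |u(0)| >
  -- 0, hence invertible in H^∞.
  set q : ℂ → ℂ := fun z => 1 + -conj (u 0) * u z with hq
  have hqH : q ∈ Hinfty := affine_mem_Hinfty hu.1 _ _
  have hqlow : ∀ z ∈ disk, 1 - ‖u 0‖ ≤ ‖q z‖ := by
    intro z hz
    have h1 : ‖conj (u 0) * u z‖ ≤ ‖u 0‖ := by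
      rw [norm_mul, RCLike.norm_conj]
      exact mul_le_of_le_one_right (norm_nonneg _) (hu.norm_le_one hz)
    have h2 := norm_sub_norm_le (1 : ℂ) (conj (u 0) * u z)
    have h3 : q z = 1 - conj (u 0) * u z := by simp only [hq]; ring
    rw [h3]
    rw [norm_one] at h2
    linarith
  have hq0 : ∀ z ∈ disk, q z ≠ 0 := fun z hz h => by
    have := hqlow z hz
    rw [h, norm_zero] at this
    linarith
  have hinv : (fun z => (q z)⁻¹) ∈ Hinfty := by
    refine ⟨DifferentiableOn.inv hqH.1 hq0, (1 - ‖u 0‖)⁻¹, fun z hz => ?_⟩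
    rw [norm_inv]
    exact inv_anti₀ (by linarith) (hqlow z hz)
  have hprod : ∀ᵐ t ∂m, bdry (fun z => (q z)⁻¹) t * bdry q t = 1 := by
    have hmul := Hinfty.mul hinv hqH
    have h1 := bdry_mul (Hinfty.mem_H2 hinv) (Hinfty.mem_H2 hqH) (Hinfty.mem_H2 hmul)
    have h2 : bdry (fun z => (q z)⁻¹ * q z) = fourierLp 2 0 := by
      refine bdry_eq hmul.1 ((isBoundaryFunction_iff hmul.1 _).2 ?_)
      refine tendsto_const_nhds.congr' ?_
      filter_upwards [eventually_radius] with r hr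
      refine Lp.ext ?_
      filter_upwards [coeFn_dilateLp hmul.1 hr.1 hr.2, coeFn_fourierLp (T := 1) 2 0] with t a b
      rw [a, b, fourier_zero, dilate, inv_mul_cancel₀ (hq0 _ (mem_disk_of_radius hr.1 hr.2 t))]
    rw [h2] at h1
    filter_upwards [h1, coeFn_fourierLp (T := 1) 2 0] with t a b
    rw [← a, b, fourier_zero]
  have hW := memLp_twist hu hv φ
  have hWq : (fun t => conj (bdry v t) * bdry (fun z => φ z * backwardShift u z) t)
      =ᵐ[m] fun t => conj (bdry q t) * twist u v φ t := by
    filter_upwards [bdry_mul hφ (Hinfty.mem_H2 hS) hm, bdry_backwardShift hu.1,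
      bdry_affine hu.1 1 (-conj (u 0)), hu.norm_bdry] with t a b c d
    have hd := conj_mul_self_of_norm_eq_one d
    rw [a, b, c, twist]
    simp only [map_mul, map_add, map_neg, map_one, Complex.conj_conj]
    linear_combination (u 0 * conj (fourier 1 t : ℂ) * conj (bdry v t) * bdry φ t) * hd
  rw [mem_K_iff hv, fourierCoeff_congr_ae hWq]
  constructor
  · rintro ⟨-, h⟩ n
    have hWqL : MemLp (fun t => conj (bdry q t) * twist u v φ t) 2 m := by
      obtain ⟨C, hC⟩ := hqH.2
      exact memLp_conj_mul (Lp.aestronglyMeasurable _) (norm_bdry_le hqH.1 hC) hW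
    -- Multiplying by the conjugate of 1/q recovers W from conj(q) W.
    rw [← fourierCoeff_conj_mul hinv hWqL h n]
    refine congrFun (fourierCoeff_congr_ae ?_) _
    filter_upwards [hprod] with t ht
    rw [← mul_assoc, ← map_mul, ht, map_one, one_mul]
  · exact fun h => ⟨hm, fourierCoeff_conj_mul hqH hW h⟩

/-- With v = u and φ = 1 the twist is conj(z), whose only nonzero Fourier coefficient has index -1.
-/
lemma backwardShift_mem_K {u : ℂ → ℂ} (hu : IsInner u)
    (hc : ¬ ∃ c : ℂ, ∀ z ∈ disk, u z = c) : backwardShift u ∈ K u := by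
  have h := (mul_backwardShift_mem_K_iff hu hu hc one_mem_H2).2 fun n => ?_
  · simpa using h
  · have hae : twist u u (fun _ => 1) =ᵐ[m] fourier (-1) := by
      have h1 := coeFn_bdry_pow 0
      simp only [pow_zero] at h1
      filter_upwards [h1, hu.norm_bdry] with t a d
      have hd := conj_mul_self_of_norm_eq_one d
      rw [twist, a, Nat.cast_zero, fourier_zero, fourier_neg, map_mul]
      linear_combination conj (fourier 1 t : ℂ) * hd
    rw [fourierCoeff_congr_ae hae, fourierCoeff_fourier]
    exact Pi.single_eq_of_ne (by omega) _

/-! ### Carleson measures -/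

lemma enorm_sq_eq_lintegral (F : L2) : ‖F‖ₑ ^ 2 = ∫⁻ t, ‖F t‖ₑ ^ 2 ∂m := by
  have := eLpNorm_nnreal_pow_eq_lintegral (μ := m) (f := F) (p := 2) (by norm_num)
  simpa [Lp.enorm_def] using this

lemma lintegral_mul_eq {f φ : ℂ → ℂ} (hf : f ∈ H2) (hφ : φ ∈ H2)
    (hm : (fun z => φ z * f z) ∈ H2) :
    ∫⁻ t, ‖bdry f t‖ₑ ^ 2 * ‖bdry φ t‖ₑ ^ 2 ∂m = ‖bdry (fun z => φ z * f z)‖ₑ ^ 2 := by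
  rw [enorm_sq_eq_lintegral]
  refine lintegral_congr_ae ?_
  filter_upwards [bdry_mul hφ hf hm] with t ht
  rw [ht, enorm_mul, mul_pow, mul_comm]

/-- The Carleson integral is the squared norm of φ f, so the Carleson constant is C², with C
truncated at 0 because its sign is not assumed. -/
lemma isCarleson_of_norm_le {u φ : ℂ → ℂ} (hφ : φ ∈ H2) {C : ℝ}
    (h : ∀ f ∈ K u, (fun z => φ z * f z) ∈ H2 ∧ ‖bdry (fun z => φ z * f z)‖ ≤ C * ‖bdry f‖) :
    IsCarleson φ u := by
  refine ⟨(Real.toNNReal C) ^ 2, fun f hf => ?_⟩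
  obtain ⟨hm, hle⟩ := h f hf
  rw [lintegral_mul_eq hf.1 hφ hm, ENNReal.coe_pow, ← mul_pow]
  gcongr
  have hle' : ‖bdry (fun z => φ z * f z)‖₊ ≤ Real.toNNReal C * ‖bdry f‖₊ := by
    rw [← NNReal.coe_le_coe]
    push_cast
    exact hle.trans (by gcongr; exact le_max_left _ _)
  rw [enorm_eq_nnnorm, enorm_eq_nnnorm]
  exact_mod_cast hle'

lemma isCarleson_of_mem_Hinfty {φ : ℂ → ℂ} (hφ : φ ∈ Hinfty) (u : ℂ → ℂ) : IsCarleson φ u := by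
  obtain ⟨C, hC⟩ := hφ.2
  exact isCarleson_of_norm_le (Hinfty.mem_H2 hφ) fun f hf =>
    ⟨Hinfty.mul_mem_H2 hφ hf.1, norm_bdry_mul_le hφ.1 hC hf.1⟩

/-- The boundary functions of the functions in `𝒦_u`. -/
def boundaryK (u : ℂ → ℂ) : Submodule ℂ L2 :=
  H2T ⊓ ⨅ h : H2, (ℂ ∙ bdry (fun z => u z * h.1 z))ᗮ

/-- Closedness makes this a Banach space, as the closed graph theorem requires. -/
lemma isClosed_boundaryK (u : ℂ → ℂ) : IsClosed (boundaryK u : Set L2) := by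
  rw [boundaryK, Submodule.coe_inf, Submodule.coe_iInf]
  exact (Submodule.isClosed_topologicalClosure _).inter
    (isClosed_iInter fun _ => Submodule.isClosed_orthogonal _)

lemma bdry_mem_boundaryK_iff {u f : ℂ → ℂ} (hf : f ∈ H2) : bdry f ∈ boundaryK u ↔ f ∈ K u := by
  simp only [boundaryK, Submodule.mem_inf, Submodule.mem_iInf,
    Submodule.mem_orthogonal_singleton_iff_inner_right]
  exact ⟨fun h => ⟨hf, fun g hg => h.2 ⟨g, hg⟩⟩, fun h => ⟨bdry_mem_H2T hf, fun g => h.2 g.1 g.2⟩⟩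

lemma exists_mem_K {u : ℂ → ℂ} {F : L2} (hF : F ∈ boundaryK u) : ∃ f ∈ K u, bdry f = F := by
  obtain ⟨f, hf, rfl⟩ := exists_bdry_eq hF.1
  exact ⟨f, (bdry_mem_boundaryK_iff hf).1 hF, rfl⟩

/-- A function in `H²` that multiplies `𝒦_u` into `H²` defines a Carleson measure for `𝒦_u`. -/
lemma isCarleson_of_mul_mem_H2 {u φ : ℂ → ℂ} (hφ : φ ∈ H2)
    (h : ∀ f ∈ K u, (fun z => φ z * f z) ∈ H2) : IsCarleson φ u := by
  have : CompleteSpace (boundaryK u) := (isClosed_boundaryK u).completeSpace_coe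
  have hmem : ∀ F : boundaryK u, MemLp (fun t => bdry φ t * (F : L2) t) 2 m := by
    rintro ⟨F, hF⟩
    obtain ⟨f, hf, rfl⟩ := exists_mem_K hF
    exact (memLp_congr_ae (bdry_mul hφ hf.1 (h f hf))).1 (Lp.memLp _)
  let T : boundaryK u →ₗ[ℂ] L2 :=
    { toFun := fun F => (hmem F).toLp
      map_add' := fun F G => by
        rw [← MemLp.toLp_add]
        refine MemLp.toLp_congr _ _ ?_
        filter_upwards [Lp.coeFn_add (F : L2) (G : L2)] with t ht
        rw [Submodule.coe_add, ht]
        simp [mul_add]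
      map_smul' := fun c F => by
        rw [RingHom.id_apply, ← MemLp.toLp_const_smul]
        refine MemLp.toLp_congr _ _ ?_
        filter_upwards [Lp.coeFn_smul c (F : L2)] with t ht
        rw [Submodule.coe_smul, ht]
        simp [mul_left_comm] }
  -- Seen in L¹, T is multiplication by φ, which is continuous from L²; as L² embeds in L¹, the
  -- graph of T is closed.
  have hT1 : ∀ F : boundaryK u, mulL1 (bdry φ) F = mulL1 (fourierLp 2 0) (T F) := fun F => by
    refine Lp.ext ?_
    filter_upwards [coeFn_mulL1 (bdry φ) F, coeFn_mulL1_one (T F), (hmem F).coeFn_toLp]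
      with t a b c
    rw [a, b]
    exact c.symm
  have hcont : Continuous T := by
    refine T.continuous_of_seq_closed_graph fun F F₀ G hF hTF => ?_
    have h1 : Tendsto (fun n => mulL1 (bdry φ) (F n)) atTop (𝓝 (mulL1 (bdry φ) F₀)) :=
      tendsto_mulL1 tendsto_const_nhds ((continuous_subtype_val.tendsto F₀).comp hF)
    have h2 : Tendsto (fun n => mulL1 (fourierLp 2 0) (T (F n))) atTop
        (𝓝 (mulL1 (fourierLp 2 0) G)) := tendsto_mulL1 tendsto_const_nhds hTF
    simp_rw [hT1] at h1
    have h3 := tendsto_nhds_unique h2 h1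
    refine Lp.ext ?_
    filter_upwards [coeFn_mulL1_one G, coeFn_mulL1_one (T F₀)] with t a b
    rw [← a, ← b, h3]
  let T' : boundaryK u →L[ℂ] L2 := ⟨T, hcont⟩
  refine isCarleson_of_norm_le hφ (C := ‖T'‖) fun f hf => ⟨h f hf, ?_⟩
  have hF : bdry f ∈ boundaryK u := (bdry_mem_boundaryK_iff hf.1).2 hf
  have hTf : T' ⟨bdry f, hF⟩ = bdry (fun z => φ z * f z) := by
    refine Lp.ext ?_
    filter_upwards [(hmem ⟨bdry f, hF⟩).coeFn_toLp, bdry_mul hφ hf.1 (h f hf)] with t a b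
    rw [b]
    exact a
  rw [← hTf]
  exact T'.le_opNorm _

/-! ### Multipliers -/

/-- If `\overline{z v} u φ` is orthogonal to `H²` and `|φ|² dm` is a Carleson measure for `𝒦_u`,
then `φ` multiplies `𝒦_u` into `𝒦_v`. -/
lemma mem_multipliers {u v φ : ℂ → ℂ} (hu : IsInner u) (hv : IsInner v) (hφ : φ ∈ H2)
    (hker : ∀ n : ℕ, fourierCoeff (twist u v φ) n = 0) (hCar : IsCarleson φ u) :
    φ ∈ Multipliers u v := by
  refine ⟨hφ.1, fun f hf => ?_⟩
  obtain ⟨C, hC⟩ := hCar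
  have hPm : MemLp (fun t => bdry φ t * bdry f t) 2 m := by
    refine ⟨(Lp.aestronglyMeasurable _).mul (Lp.aestronglyMeasurable _), ?_⟩
    rw [eLpNorm_lt_top_iff_lintegral_rpow_enorm_lt_top (by norm_num) (by norm_num)]
    refine lt_of_le_of_lt (le_of_eq ?_) ((hC f hf).trans_lt
      (ENNReal.mul_lt_top ENNReal.coe_lt_top (ENNReal.pow_lt_top enorm_lt_top)))
    refine lintegral_congr fun t => ?_
    simp [enorm_mul, mul_pow, mul_comm]
  obtain ⟨hm, hb⟩ := mul_mem_H2 hφ hf.1 hPm.coeFn_toLp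
  refine (mem_K_iff hv).2 ⟨hm, fun n => ?_⟩
  obtain ⟨-, hf0⟩ := (mem_K_iff hu).1 hf
  -- This is z^n g with g = conj(z) u conj(f), hence the exponent n - 1.
  have hgm : MemLp (fun t => fourier ((n : ℤ) - 1) t * (bdry u t * conj (bdry f t))) 2 m := by
    refine (Lp.memLp (bdry f)).of_le_mul (c := 1)
      ((fourier _).continuous.aestronglyMeasurable.mul ((Lp.aestronglyMeasurable _).mul
        (Complex.continuous_conj.comp_aestronglyMeasurable (Lp.aestronglyMeasurable _)))) ?_
    filter_upwards [hu.norm_bdry] with t ht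
    rw [norm_mul, norm_mul, norm_fourier, ht, RCLike.norm_conj, one_mul]
  -- Its coefficient of index -(j + 1) is the conjugate of the coefficient of conj(u) f of index n +
  -- j ≥ 0, which vanishes because f ∈ K_u.
  have hgH : hgm.toLp ∈ H2T := by
    refine mem_H2T_iff.2 fun j => ?_
    rw [fourierCoeff_congr_ae hgm.coeFn_toLp, ← map_eq_zero (starRingEnd ℂ),
      ← hf0 (n + j), fourierCoeff_eq_integral, fourierCoeff_eq_integral, ← integral_conj]
    refine integral_congr_ae (ae_of_all _ fun t => ?_)
    have h1 : (fourier (Int.negSucc j) t : ℂ) * conj (fourier ((n : ℤ) - 1) t : ℂ)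
        = conj (fourier ((n + j : ℕ) : ℤ) t : ℂ) := by
      rw [← fourier_neg, ← fourier_neg, ← fourier_add]
      congr 2
      push_cast [Int.negSucc_eq]
      ring
    simp only [map_mul, Complex.conj_conj]
    rw [← h1]
    ring
  rw [fourierCoeff_eq_integral, ← integral_conj_mul_eq_zero hgH (memLp_twist hu hv φ) hker]
  refine integral_congr_ae ?_
  rw [hb]
  filter_upwards [hPm.coeFn_toLp, hgm.coeFn_toLp, hu.norm_bdry] with t a b d
  have hd := conj_mul_self_of_norm_eq_one d
  have h1 : conj (fourier ((n : ℤ) - 1) t : ℂ) * conj (fourier 1 t : ℂ)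
      = conj (fourier (n : ℤ) t : ℂ) := by
    rw [← map_mul, ← fourier_add, sub_add_cancel]
  rw [a, b, twist, ← h1]
  simp only [map_mul, Complex.conj_conj]
  linear_combination (-(conj (fourier ((n : ℤ) - 1) t : ℂ) * conj (fourier 1 t : ℂ)
    * conj (bdry v t) * bdry φ t * bdry f t)) * hd

/-- A function `φ ∈ H²` with `φ S^* u` bounded is itself bounded. -/
lemma mem_Hinfty_of_mul_backwardShift {u φ : ℂ → ℂ} (hu : IsInner u)
    (hc : ¬ ∃ c : ℂ, ∀ z ∈ disk, u z = c) (hφ : φ ∈ H2)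
    (h : (fun z => φ z * backwardShift u z) ∈ Hinfty) : φ ∈ Hinfty := by
  obtain ⟨C, hC⟩ := h.2
  have hlt := hu.norm_zero_lt_one hc
  have hC0 : 0 ≤ C := (norm_nonneg _).trans (hC 0 (by simp))
  refine ⟨hφ.1, C / (1 - ‖u 0‖), fun z hz => norm_le_of_norm_bdry_le hφ
    (div_nonneg hC0 (by linarith)) ?_ hz⟩
  have hS := backwardShift_mem_Hinfty hu.1
  -- On the circle |φ| |u - u(0)| ≤ C and |u - u(0)| ≥ 1 - |u(0)|; this is the origin of the bound C
  -- / (1 - |u(0)|).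
  filter_upwards [norm_bdry_le h.1 hC, bdry_mul hφ (Hinfty.mem_H2 hS) (Hinfty.mem_H2 h),
    bdry_backwardShift hu.1, hu.norm_bdry] with t a b c d
  rw [b, c, norm_mul, norm_mul, RCLike.norm_conj, norm_fourier, one_mul] at a
  rw [le_div_iff₀ (by linarith)]
  refine le_trans ?_ a
  gcongr
  have := norm_sub_norm_le (bdry u t) (u 0)
  rwa [d] at this

end ModelSpace

end

/-! ### The two equivalences -/

theorem theorem3p1 (u v φ : ℂ → ℂ)
    (hu : ModelSpace.IsInner u) (hv : ModelSpace.IsInner v)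
    (hu_nonconst : ¬ ∃ c : ℂ, ∀ z ∈ ModelSpace.disk, u z = c)
    (hφ : φ ∈ ModelSpace.H2) :
    List.TFAE
      [φ ∈ ModelSpace.Multipliers u v,
        (fun z => φ z * ModelSpace.backwardShift u z) ∈ ModelSpace.K v ∧
          ModelSpace.IsCarleson φ u,
        φ ∈ ModelSpace.kerToeplitz (ModelSpace.symbol hu hv) ∧ ModelSpace.IsCarleson φ u] ∧
    List.TFAE
      [φ ∈ ModelSpace.Multipliers u v ∩ ModelSpace.Hinfty,
        (fun z => φ z * ModelSpace.backwardShift u z) ∈ ModelSpace.K v ∩ ModelSpace.Hinfty,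
        φ ∈ ModelSpace.kerToeplitz (ModelSpace.symbol hu hv) ∩ ModelSpace.Hinfty] := by
  have hiff : (fun z => φ z * ModelSpace.backwardShift u z) ∈ ModelSpace.K v ↔
      φ ∈ ModelSpace.kerToeplitz (ModelSpace.symbol hu hv) := by
    rw [ModelSpace.mul_backwardShift_mem_K_iff hu hv hu_nonconst hφ,
      ModelSpace.mem_kerToeplitz_iff hu hv, and_iff_right hφ]
  have hS := ModelSpace.backwardShift_mem_K hu hu_nonconst
  have hmult : φ ∈ ModelSpace.kerToeplitz (ModelSpace.symbol hu hv) →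
      ModelSpace.IsCarleson φ u → φ ∈ ModelSpace.Multipliers u v := fun h hC =>
    ModelSpace.mem_multipliers hu hv hφ ((ModelSpace.mem_kerToeplitz_iff hu hv).1 h).2 hC
  constructor
  · tfae_have 1 → 2 := fun h =>
      ⟨h.2 _ hS, ModelSpace.isCarleson_of_mul_mem_H2 hφ fun f hf => (h.2 f hf).1⟩
    tfae_have 2 → 3 := fun h => ⟨hiff.1 h.1, h.2⟩
    tfae_have 3 → 1 := fun h => hmult h.1 h.2
    tfae_finish
  · tfae_have 1 → 2 := fun h => ⟨h.1.2 _ hS,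
      ModelSpace.Hinfty.mul h.2 (ModelSpace.backwardShift_mem_Hinfty hu.1)⟩
    tfae_have 2 → 3 := fun h => ⟨hiff.1 h.1,
      ModelSpace.mem_Hinfty_of_mul_backwardShift hu hu_nonconst hφ h.2⟩
    tfae_have 3 → 1 := fun h =>
      ⟨hmult h.1 (ModelSpace.isCarleson_of_mem_Hinfty h.2 u), h.2⟩
    tfae_finish
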